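/- Theorem. There are no $2$-designs of type I. That is, let $f$ be a positive integer with $q=2^f>8$. There do not exist a $2$-$\left(\frac{q(q-1)}{2},\frac q2,2\right)$ design $\mathcal D=(\mathcal P,\mathcal B)$ (a set $\mathcal P$ of $v=\frac{q(q-1)}{2}$ points and a set $\mathcal B$ of subsets of $\mathcal P$, called blocks, all of size $k=\frac q2$, such that any two distinct points lie in exactly $2$ blocks) with exactly $b=2(q^2-1)$ blocks and exactly $r=2(q+1)$ blocks through each point, and a group $G$ of permutations of $\mathcal P$ preserving $\mathcal B$, such that \begin{itemize} \item $G$ acts transitively on the flags of $\mathcal D$, i.e. on the pairs $(x,B)$ with $x\in B\in\mathcal B$; \item the socle $T$ of $G$ (the subgroup generated by the minimal normal subgroups of $G$) is isomorphic to $PSL(2,q)$; \item for every point $x$, the stabilizer $T_x$ is isomorphic to the dihedral group $D_{2(q+1)}$ of order $2(q+1)$; \item for every block $B$, the setwise stabilizer $T_B$ is isomorphic to $\mathbb Z_2^{f-1}$ or to $\mathbb Z_2^{f}$. \end{itemize} -/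

import Mathlib

open scoped Pointwise

/-- The socle of a group: the subgroup generated by all its minimal normal subgroups. -/
def groupSocle (G : Type*) [Group G] : Subgroup G :=
  sSup {N : Subgroup G | Minimal (fun M : Subgroup G => M.Normal ∧ M ≠ ⊥) N}

/-- `𝓑` is the block set of a 2-`(v, k, lam)` design on the point set `P`. Blocks are subsets of
`P`, so there are no repeated blocks. -/
structure IsTwoDesign {P : Type*} (𝓑 : Set (Set P)) (v k lam : ℕ) : Prop where
  card_points : Nat.card P = v
  card_block : ∀ B ∈ 𝓑, B.ncard = k
  card_pair : ∀ x y : P, x ≠ y → {B ∈ 𝓑 | x ∈ B ∧ y ∈ B}.ncard = lam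

/-- The automorphism group of the incidence structure `(P, 𝓑)`: all permutations `g` of `P` with
`{g(B) : B ∈ 𝓑} = 𝓑`. -/
def designAut {P : Type*} (𝓑 : Set (Set P)) : Subgroup (Equiv.Perm P) :=
  MulAction.stabilizer (Equiv.Perm P) 𝓑

/-- `G` is transitive on the flags of `(P, 𝓑)`, the pairs `(x, B)` with `x ∈ B ∈ 𝓑`. -/
def IsFlagTransitive {P : Type*} (𝓑 : Set (Set P)) (G : Subgroup (Equiv.Perm P)) : Prop :=
  ∀ (x y : P) (B C : Set P), B ∈ 𝓑 → x ∈ B → C ∈ 𝓑 → y ∈ C →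
    ∃ g ∈ G, g • x = y ∧ g • B = C

/-- The elementary abelian group `Z_2^n`, written multiplicatively. -/
abbrev ElemAbelianTwo (n : ℕ) : Type := Multiplicative (Fin n → ZMod 2)

/-- `(P, 𝓑)`, together with the group `G`, is a 2-design of type I for `q = 2 ^ f`. The socle of
`G` plays the role of `T`; `DihedralGroup (q + 1)` is the dihedral group of order `2 (q + 1)`. -/
structure IsTypeI {P : Type*} (𝓑 : Set (Set P)) (G : Subgroup (Equiv.Perm P)) (q f : ℕ) :
    Prop where
  q_eq : q = 2 ^ f
  q_gt : 8 < q
  design : IsTwoDesign 𝓑 (q * (q - 1) / 2) (q / 2) 2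
  nontrivial : 2 < q / 2 ∧ q / 2 < q * (q - 1) / 2 - 1
  card_blocks : 𝓑.ncard = 2 * (q ^ 2 - 1)
  card_blocks_through : ∀ x : P, {B ∈ 𝓑 | x ∈ B}.ncard = 2 * (q + 1)
  le_aut : G ≤ designAut 𝓑
  flag_transitive : IsFlagTransitive 𝓑 G
  socle_iso : Nonempty
    (groupSocle G ≃* Matrix.ProjectiveSpecialLinearGroup (Fin 2) (GaloisField 2 f))
  point_stabilizer : ∀ x : P,
    Nonempty (MulAction.stabilizer (groupSocle G) x ≃* DihedralGroup (q + 1))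
  block_stabilizer : ∀ B ∈ 𝓑,
    Nonempty (MulAction.stabilizer (groupSocle G) B ≃* ElemAbelianTwo (f - 1)) ∨
    Nonempty (MulAction.stabilizer (groupSocle G) B ≃* ElemAbelianTwo f)

/-! Write `q = 2m` and `T = PSL(2,q) = SL(2,q)`. The centralizer of an involution `w` is elementary
abelian of order `q`, and centralizers of involutions meet trivially or coincide. A point stabilizer
has `q + 1` involutions, no two commuting. So each involution fixes `m` points, and the fixed-point
sets of the involutions in `C(w)` partition the points and are the orbits of `C(w)`
(`exists_fixing`, `orbit_centralizer_eq`).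

A block whose stabilizer has order `q` is the fixed-point set of an involution. There are at most
`q² - 1` of these, too few, so some block `B` has a stabilizer `W` of order `m`, and then `T` is
transitive on blocks. Here `B` is a union of two `W`-orbits of length `m/2`, fixed pointwise by
distinct `u, v ∈ W`.

Let `x ∈ B` be fixed by `u`. Each `t ∈ W` outside `{1, u}` swaps `x` and `tx`, hence stabilizes the
second block through them. All these second blocks coincide in one block `D = gB` with stabilizer
`W` and `g⁻¹ug = v`. So `g` normalizes `W`; but `N(W) ≤ C(w)` (`normalizer_le`), so `g` commutes
with `u` and `u = v`, a contradiction. -/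

/-- An involution of a group. -/
def IsInvolution {T : Type*} [Group T] (u : T) : Prop := u ≠ 1 ∧ u * u = 1

/-- The properties of `SL(2, q)`, `q` even, on which the argument rests: its order, the number of
its involutions, their conjugacy, and the structure of their centralizers. -/
structure HasTIInvolutions (T : Type*) [Group T] (q : ℕ) : Prop where
  card_eq : Nat.card T = q * (q ^ 2 - 1)
  card_involutions : {u : T | IsInvolution u}.ncard = q ^ 2 - 1
  isConj : ∀ u v : T, IsInvolution u → IsInvolution v → IsConj u v
  card_centralizer : ∀ u : T, IsInvolution u → Nat.card (Subgroup.centralizer {u}) = q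
  mul_self : ∀ u v : T, IsInvolution u → v ∈ Subgroup.centralizer {u} → v * v = 1

theorem MulEquiv.isInvolution_iff {T S : Type*} [Group T] [Group S] (e : T ≃* S) {u : T} :
    IsInvolution (e u) ↔ IsInvolution u := by
  unfold IsInvolution
  rw [← map_mul, ne_eq, map_eq_one_iff e e.injective, map_eq_one_iff e e.injective]

theorem MulEquiv.map_mem_centralizer_iff {T S : Type*} [Group T] [Group S] (e : T ≃* S) {u v : T} :
    e v ∈ Subgroup.centralizer {e u} ↔ v ∈ Subgroup.centralizer {u} := by
  rw [Subgroup.mem_centralizer_singleton_iff, Subgroup.mem_centralizer_singleton_iff,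
    ← map_mul, ← map_mul, e.injective.eq_iff]

theorem HasTIInvolutions.of_mulEquiv {T S : Type*} [Group T] [Group S] {q : ℕ} (e : T ≃* S)
    (h : HasTIInvolutions S q) : HasTIInvolutions T q where
  card_eq := by rw [Nat.card_congr e.toEquiv, h.card_eq]
  card_involutions := by
    rw [← h.card_involutions, ← Nat.card_coe_set_eq, ← Nat.card_coe_set_eq]
    exact Nat.card_congr (e.toEquiv.subtypeEquiv fun u => e.isInvolution_iff.symm)
  isConj u v hu hv := by
    have := h.isConj (e u) (e v) (e.isInvolution_iff.2 hu) (e.isInvolution_iff.2 hv)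
    simpa using MonoidHom.map_isConj e.symm.toMonoidHom this
  card_centralizer u hu := by
    rw [← h.card_centralizer (e u) (e.isInvolution_iff.2 hu)]
    exact Nat.card_congr (e.toEquiv.subtypeEquiv fun v => e.map_mem_centralizer_iff.symm)
  mul_self u v hu hv := by
    have := h.mul_self (e u) (e v) (e.isInvolution_iff.2 hu) (e.map_mem_centralizer_iff.2 hv)
    rwa [← map_mul, map_eq_one_iff e e.injective] at this

/-- A group with a class of `q ^ 2 - 1` involutions, given the centralizer of one of them. -/
theorem HasTIInvolutions.of_card {T : Type*} [Group T] [Finite T] {q : ℕ} (hq : 0 < q)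
    (hT : Nat.card T = q * (q ^ 2 - 1)) (hI : {u : T | IsInvolution u}.ncard = q ^ 2 - 1)
    (u₀ : T) (hu₀ : IsInvolution u₀) (hC : Nat.card (Subgroup.centralizer {u₀}) = q)
    (hC' : ∀ v ∈ Subgroup.centralizer {u₀}, v * v = 1) : HasTIInvolutions T q := by
  have hsub : MulAction.orbit (ConjAct T) u₀ ⊆ {u : T | IsInvolution u} := by
    rintro _ ⟨g, rfl⟩
    have : (fun m : ConjAct T => m • u₀) g = MulAut.conj (ConjAct.ofConjAct g) u₀ := by
      simp [ConjAct.smul_def]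
    rw [this]
    exact (MulEquiv.isInvolution_iff _).2 hu₀
  have hcard : (MulAction.orbit (ConjAct T) u₀).ncard = q ^ 2 - 1 := by
    have h1 := (MulAction.stabilizer (ConjAct T) u₀).card_mul_index
    rw [MulAction.index_stabilizer] at h1
    have h2 : Nat.card (MulAction.stabilizer (ConjAct T) u₀) = q := by
      rw [← hC]
      refine Nat.card_congr (ConjAct.ofConjAct.toEquiv.subtypeEquiv fun g => ?_)
      rw [MulAction.mem_stabilizer_iff, Subgroup.mem_centralizer_singleton_iff,
        ConjAct.smul_def, mul_inv_eq_iff_eq_mul]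
      rfl
    have h3 : Nat.card (ConjAct T) = q * (q ^ 2 - 1) := hT
    rw [h2, h3] at h1
    exact Nat.eq_of_mul_eq_mul_left hq h1
  have heq : MulAction.orbit (ConjAct T) u₀ = {u : T | IsInvolution u} :=
    Set.eq_of_subset_of_ncard_le hsub (by rw [hI, hcard]) (Set.toFinite _)
  have hconj : ∀ u : T, IsInvolution u → IsConj u₀ u := by
    intro u hu
    have : u ∈ MulAction.orbit (ConjAct T) u₀ := heq ▸ hu
    exact (ConjAct.mem_orbit_conjAct.1 this).symm
  have haut : ∀ u : T, IsInvolution u → ∃ e : T ≃* T, e u = u₀ := by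
    intro u hu
    obtain ⟨c, hc⟩ := isConj_iff.1 (hconj u hu).symm
    exact ⟨MulAut.conj c, hc⟩
  refine ⟨hT, hI, fun u v hu hv => (hconj u hu).symm.trans (hconj v hv), fun u hu => ?_,
    fun u v hu hv => ?_⟩
  · obtain ⟨e, he⟩ := haut u hu
    rw [← hC, ← he]
    exact Nat.card_congr (e.toEquiv.subtypeEquiv fun v => e.map_mem_centralizer_iff.symm)
  · obtain ⟨e, he⟩ := haut u hu
    have := hC' (e v) (he ▸ e.map_mem_centralizer_iff.2 hv)
    rwa [← map_mul, map_eq_one_iff e e.injective] at this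

/-! ### Involutions of `SL(2, F)` in characteristic two. -/

section SpecialLinear

open Matrix

variable {F : Type*} [Field F]

theorem card_specialLinearGroup_fin_two [Finite F] :
    Nat.card (Matrix.SpecialLinearGroup (Fin 2) F) = Nat.card F * (Nat.card F ^ 2 - 1) := by
  have := Fintype.ofFinite F
  have h0 := Matrix.card_GL_field (𝔽 := F) 2
  have h1 := (GeneralLinearGroup.det (n := Fin 2) (R := F)).ker.card_mul_index
  have hsurj : Function.Surjective (GeneralLinearGroup.det (n := Fin 2) (R := F)) := by
    intro r
    refine ⟨GeneralLinearGroup.mkOfDetNeZero !![(r : F), 0; 0, 1] (by simp), ?_⟩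
    ext
    simp [GeneralLinearGroup.mkOfDetNeZero]
  have h2 : (GeneralLinearGroup.det (n := Fin 2) (R := F)).ker.index = Nat.card F - 1 := by
    rw [Subgroup.index_ker, MonoidHom.range_eq_top.2 hsurj, Subgroup.card_top, Nat.card_units]
  have h3 : Nat.card (Matrix.SpecialLinearGroup (Fin 2) F) =
      Nat.card (GeneralLinearGroup.det (n := Fin 2) (R := F)).ker := by
    refine Nat.card_congr ((Equiv.ofInjective _ SpecialLinearGroup.toGL_injective).trans
      (Equiv.setCongr ?_))
    rw [SpecialLinearGroup.range_toGL]
    rfl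
  rw [h2, h0, ← h3, Fin.prod_univ_two, ← Nat.card_eq_fintype_card] at h1
  -- This substitution removes the truncated subtractions.
  obtain ⟨m, hm⟩ : ∃ m, Nat.card F = m + 2 :=
    Nat.exists_eq_add_of_le' (Finite.one_lt_card (α := F))
  rw [hm] at h1 ⊢
  have h4 : (m + 2) ^ 2 - (m + 2) = (m + 2) * (m + 1) := by
    rw [Nat.sub_eq_iff_eq_add (by nlinarith)]; ring
  simp only [Fin.val_zero, Fin.val_one, pow_zero, pow_one, h4, Nat.reduceSubDiff] at h1
  refine Nat.eq_of_mul_eq_mul_right (Nat.succ_pos m) (h1.trans ?_)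
  simp only [Nat.succ_eq_add_one]
  ring

theorem center_specialLinearGroup_fin_two_eq_bot [CharP F 2] :
    Subgroup.center (Matrix.SpecialLinearGroup (Fin 2) F) = ⊥ := by
  rw [eq_bot_iff]
  intro A hA
  obtain ⟨r, hr, hrA⟩ := Matrix.SpecialLinearGroup.mem_center_iff.1 hA
  have : r = 1 := by
    rw [Fintype.card_fin] at hr
    exact CharTwo.sq_injective (by simpa using hr)
  subst this
  rw [Subgroup.mem_bot]
  ext i j
  rw [← hrA]
  simp

theorem slTwo_ext_iff {A B : Matrix.SpecialLinearGroup (Fin 2) F} :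
    A = B ↔ A 0 0 = B 0 0 ∧ A 0 1 = B 0 1 ∧ A 1 0 = B 1 0 ∧ A 1 1 = B 1 1 := by
  constructor
  · rintro rfl
    simp
  · rintro ⟨h1, h2, h3, h4⟩
    ext i j
    fin_cases i <;> fin_cases j <;> assumption

theorem slTwo_det (A : Matrix.SpecialLinearGroup (Fin 2) F) :
    A 0 0 * A 1 1 - A 0 1 * A 1 0 = 1 :=
  (Matrix.det_fin_two A.1).symm.trans A.2

theorem slTwo_mul_apply (A B : Matrix.SpecialLinearGroup (Fin 2) F)
    (i j : Fin 2) : (A * B) i j = A i 0 * B 0 j + A i 1 * B 1 j :=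
  (Matrix.mul_apply (M := A.1) (N := B.1)).trans (Fin.sum_univ_two _)

theorem slTwo_one_apply (i j : Fin 2) :
    (1 : Matrix.SpecialLinearGroup (Fin 2) F) i j = if i = j then 1 else 0 :=
  Matrix.one_apply

/-- By Cayley–Hamilton, `A² = tr(A) A + 1` in characteristic two, so `A² = 1` exactly when the trace
vanishes. The proof does this entrywise. -/
theorem slTwo_isInvolution_iff [CharP F 2] (A : Matrix.SpecialLinearGroup (Fin 2) F) :
    IsInvolution A ↔ A ≠ 1 ∧ A 0 0 = A 1 1 := by
  unfold IsInvolution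
  refine and_congr_right fun hA => ?_
  have hdet := slTwo_det A
  have h2 : (2 : F) = 0 := CharTwo.two_eq_zero
  rw [ne_eq, slTwo_ext_iff] at hA
  rw [slTwo_ext_iff]
  simp only [slTwo_mul_apply, slTwo_one_apply, if_true, zero_ne_one, one_ne_zero, if_false] at hA ⊢
  generalize A 0 0 = a at *
  generalize A 0 1 = b at *
  generalize A 1 0 = c at *
  generalize A 1 1 = d at *
  constructor
  · rintro ⟨e1, e2, e3, e4⟩
    by_contra hne
    have hs : a + d ≠ 0 := fun h => hne (by linear_combination h - d * h2)
    have hb : b = 0 := (mul_eq_zero.1 (by linear_combination e2 : b * (a + d) = 0)).resolve_right hs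
    have hc : c = 0 := (mul_eq_zero.1 (by linear_combination e3 : c * (a + d) = 0)).resolve_right hs
    subst hb hc
    have ha : a = 1 := CharTwo.sq_injective (by simpa [sq] using e1)
    have hd : d = 1 := CharTwo.sq_injective (by simpa [sq] using e4)
    exact hne (ha.trans hd.symm)
  · rintro rfl
    refine ⟨?_, ?_, ?_, ?_⟩
    · linear_combination hdet + b * c * h2
    · linear_combination a * b * h2
    · linear_combination a * c * h2
    · linear_combination hdet + b * c * h2

/-- Off-diagonal entries `b, c` may be arbitrary: the common diagonal entry is the unique square
root of `1 + bc`. The identity is then discarded. -/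
theorem ncard_involutions_specialLinearGroup [Finite F] [CharP F 2] :
    {A : Matrix.SpecialLinearGroup (Fin 2) F | IsInvolution A}.ncard = Nat.card F ^ 2 - 1 := by
  have h1 : {A : Matrix.SpecialLinearGroup (Fin 2) F | IsInvolution A} =
      {A | A 0 0 = A 1 1} \ {1} := by
    ext A
    simp [slTwo_isInvolution_iff, and_comm]
  rw [h1, Set.ncard_sdiff_singleton_of_mem (by simp)]
  congr 1
  rw [sq, ← Nat.card_prod, ← Nat.card_coe_set_eq]
  refine Nat.card_congr (Equiv.ofBijective (fun A => (A.1 0 1, A.1 1 0)) ⟨?_, ?_⟩)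
  · rintro ⟨A, hA⟩ ⟨B, hB⟩ hAB
    simp only [Prod.mk.injEq, Set.mem_ofPred_eq] at hAB hA hB
    have dA := slTwo_det A
    have dB := slTwo_det B
    have : A 0 0 = B 0 0 := by
      refine CharTwo.sq_injective ?_
      rw [← hA, hAB.1, hAB.2] at dA
      rw [← hB] at dB
      change A 0 0 ^ 2 = B 0 0 ^ 2
      linear_combination dA - dB
    rw [Subtype.mk.injEq, slTwo_ext_iff]
    exact ⟨this, hAB.1, hAB.2, by rw [← hA, ← hB, this]⟩
  · rintro ⟨b, c⟩
    obtain ⟨a, ha⟩ := FiniteField.isSquare_of_char_two (ringChar.eq F 2) (1 + b * c)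
    exact ⟨⟨⟨!![a, b; c, a], by rw [Matrix.det_fin_two_of, ← ha]; ring⟩, rfl⟩, rfl⟩

/-- The upper unitriangular matrix with upper right entry `b`. -/
def upperUnipotent (b : F) : Matrix.SpecialLinearGroup (Fin 2) F := ⟨!![1, b; 0, 1], by simp⟩

theorem mem_centralizer_upperUnipotent_iff [CharP F 2] (A : Matrix.SpecialLinearGroup (Fin 2) F) :
    A ∈ Subgroup.centralizer {upperUnipotent (1 : F)} ↔
      A 0 0 = 1 ∧ A 1 0 = 0 ∧ A 1 1 = 1 := by
  have hdet := slTwo_det A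
  rw [Subgroup.mem_centralizer_singleton_iff, slTwo_ext_iff]
  simp only [slTwo_mul_apply]
  change A 0 0 * 1 + A 0 1 * 0 = 1 * A 0 0 + 1 * A 1 0 ∧
    A 0 0 * 1 + A 0 1 * 1 = 1 * A 0 1 + 1 * A 1 1 ∧
    A 1 0 * 1 + A 1 1 * 0 = 0 * A 0 0 + 1 * A 1 0 ∧
    A 1 0 * 1 + A 1 1 * 1 = 0 * A 0 1 + 1 * A 1 1 ↔ _
  constructor
  · rintro ⟨e1, e2, -, -⟩
    have hc : A 1 0 = 0 := by linear_combination -e1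
    have had : A 0 0 = A 1 1 := by linear_combination e2
    rw [hc, had] at hdet
    have : A 1 1 = 1 := by
      refine CharTwo.sq_injective ?_
      change A 1 1 ^ 2 = 1 ^ 2
      linear_combination hdet
    exact ⟨had.trans this, hc, this⟩
  · rintro ⟨h1, h3, h4⟩
    rw [h1, h3, h4]
    refine ⟨?_, ?_, ?_, ?_⟩ <;> ring

/-- `SL(2, F)` for a finite field `F` of characteristic two. -/
theorem hasTIInvolutions_specialLinearGroup [Finite F] [CharP F 2] :
    HasTIInvolutions (Matrix.SpecialLinearGroup (Fin 2) F) (Nat.card F) := by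
  refine .of_card Nat.card_pos card_specialLinearGroup_fin_two
    ncard_involutions_specialLinearGroup (upperUnipotent 1) ?_ ?_ ?_
  · rw [slTwo_isInvolution_iff]
    refine ⟨fun h => ?_, rfl⟩
    exact one_ne_zero (slTwo_ext_iff.1 h).2.1
  · refine Nat.card_congr (Equiv.ofBijective (fun A => A.1 0 1) ⟨?_, ?_⟩)
    · rintro ⟨A, hA⟩ ⟨B, hB⟩ hAB
      obtain ⟨a1, a2, a3⟩ := (mem_centralizer_upperUnipotent_iff A).1 hA
      obtain ⟨b1, b2, b3⟩ := (mem_centralizer_upperUnipotent_iff B).1 hB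
      rw [Subtype.mk.injEq, slTwo_ext_iff]
      exact ⟨a1.trans b1.symm, hAB, a2.trans b2.symm, a3.trans b3.symm⟩
    · intro b
      exact ⟨⟨upperUnipotent b, (mem_centralizer_upperUnipotent_iff _).2 ⟨rfl, rfl, rfl⟩⟩, rfl⟩
  · intro A hA
    obtain ⟨a1, -, a3⟩ := (mem_centralizer_upperUnipotent_iff A).1 hA
    by_cases h : A = 1
    · simp [h]
    · exact ((slTwo_isInvolution_iff A).2 ⟨h, a1.trans a3.symm⟩).2

/-- `PSL(2, F)` for a finite field `F` of characteristic two. -/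
theorem hasTIInvolutions_projectiveSpecialLinearGroup [Finite F] [CharP F 2] :
    HasTIInvolutions (ProjectiveSpecialLinearGroup (Fin 2) F) (Nat.card F) :=
  .of_mulEquiv ((QuotientGroup.quotientMulEquivOfEq
    center_specialLinearGroup_fin_two_eq_bot).trans QuotientGroup.quotientBot)
    hasTIInvolutions_specialLinearGroup

end SpecialLinear

/-! ### Centralizers of involutions as a trivial intersection family. -/

theorem IsInvolution.conj {T : Type*} [Group T] {u : T} (hu : IsInvolution u) (g : T) :
    IsInvolution (g * u * g⁻¹) :=
  (MulEquiv.isInvolution_iff (MulAut.conj g)).2 hu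

theorem conj_mem_centralizer_conj_iff {T : Type*} [Group T] (g u v : T) :
    g * v * g⁻¹ ∈ Subgroup.centralizer {g * u * g⁻¹} ↔ v ∈ Subgroup.centralizer {u} :=
  MulEquiv.map_mem_centralizer_iff (MulAut.conj g)

theorem Subgroup.self_mem_centralizer_singleton {T : Type*} [Group T] (u : T) :
    u ∈ Subgroup.centralizer {u} :=
  Subgroup.mem_centralizer_singleton_iff.2 rfl

/-- `C(u)` has exponent two, so it is abelian and lies in `C(v)`; the orders agree. -/
theorem HasTIInvolutions.centralizer_eq {T : Type*} [Group T] [Finite T] {q : ℕ}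
    (hT : HasTIInvolutions T q) {u v : T} (hu : IsInvolution u)
    (hv : v ∈ Subgroup.centralizer {u}) (hv1 : v ≠ 1) :
    Subgroup.centralizer {v} = Subgroup.centralizer {u} := by
  have hvi : IsInvolution v := ⟨hv1, hT.mul_self u v hu hv⟩
  refine (Subgroup.eq_of_le_of_card_ge (fun t ht => ?_) ?_).symm
  · rw [Subgroup.mem_centralizer_singleton_iff]
    have h1 := hT.mul_self u _ hu (mul_mem ht hv)
    have h2 := hT.mul_self u _ hu ht
    rw [← inv_eq_iff_mul_eq_one] at h1 h2
    rw [mul_inv_rev, h2, inv_eq_iff_mul_eq_one.2 hvi.2] at h1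
    exact h1.symm
  · rw [hT.card_centralizer u hu, hT.card_centralizer v hvi]

theorem HasTIInvolutions.mem_centralizer_of_mem {T : Type*} [Group T] [Finite T] {q : ℕ}
    (hT : HasTIInvolutions T q) {w u v : T} (hw : IsInvolution w)
    (hu : u ∈ Subgroup.centralizer {w}) (hv : v ∈ Subgroup.centralizer {w}) :
    u ∈ Subgroup.centralizer {v} := by
  by_cases hv1 : v = 1
  · simp [hv1, Subgroup.mem_centralizer_singleton_iff]
  · rwa [hT.centralizer_eq hw hv hv1]

/-- If `g` conjugates a nontrivial element of `C(w)` into `C(w)` then it normalizes `C(w)`. -/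
theorem HasTIInvolutions.conj_mem_centralizer_iff {T : Type*} [Group T] [Finite T] {q : ℕ}
    (hT : HasTIInvolutions T q) {w t g : T} (hw : IsInvolution w)
    (ht : t ∈ Subgroup.centralizer {w}) (ht1 : t ≠ 1)
    (hg : g * t * g⁻¹ ∈ Subgroup.centralizer {w}) (z : T) :
    g * z * g⁻¹ ∈ Subgroup.centralizer {w} ↔ z ∈ Subgroup.centralizer {w} := by
  rw [← hT.centralizer_eq hw hg (by simpa using ht1), conj_mem_centralizer_conj_iff,
    hT.centralizer_eq hw ht ht1, hT.centralizer_eq hw hg (by simpa using ht1)]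

theorem Subgroup.le_centralizer_of_mul_self {T : Type*} [Group T] {w : T} {W : Subgroup T}
    (hW : ∀ t ∈ W, t * t = 1) (hw : w ∈ W) : W ≤ Subgroup.centralizer {w} := by
  intro t ht
  rw [Subgroup.mem_centralizer_singleton_iff]
  have h1 := hW _ (mul_mem ht hw)
  rw [← inv_eq_iff_mul_eq_one, mul_inv_rev, inv_eq_iff_mul_eq_one.2 (hW t ht),
    inv_eq_iff_mul_eq_one.2 (hW w hw)] at h1
  exact h1.symm

/-- All orbits have the same length `|K| / c`. -/
theorem MulAction.card_dvd_of_card_stabilizer_eq {K X : Type*} [Group K] [MulAction K X] [Finite K]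
    [Finite X] {c : ℕ} (h : ∀ x : X, Nat.card (MulAction.stabilizer K x) = c) :
    Nat.card K / c ∣ Nat.card X := by
  classical
  have := Fintype.ofFinite K
  have := Fintype.ofFinite X
  have h1 := MulAction.card_eq_sum_card_group_div_card_stabilizer K X
  simp only [← Nat.card_eq_fintype_card, h, Finset.sum_const] at h1
  rw [h1, smul_eq_mul]
  exact Dvd.intro_left _ rfl

/-- A subgroup of index two of an elementary abelian TI subgroup `C(w)` has normalizer `C(w)`. -/
theorem HasTIInvolutions.normalizer_le {T : Type*} [Group T] [Finite T] {m : ℕ}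
    (hT : HasTIInvolutions T (2 * m)) (hm : 1 < m) {w : T} (hw : IsInvolution w) {W : Subgroup T}
    (hW : W ≤ Subgroup.centralizer {w}) (hcard : Nat.card W = m) :
    Subgroup.normalizer (W : Set T) ≤ Subgroup.centralizer {w} := by
  set K := Subgroup.normalizer (W : Set T) with hK
  have hUK : Subgroup.centralizer {w} ≤ K := by
    intro t ht
    rw [hK, Subgroup.mem_normalizer_iff]
    have key : ∀ h ∈ Subgroup.centralizer {w}, t * h * t⁻¹ = h := fun h hh =>
      mul_inv_eq_iff_eq_mul.2
        (Subgroup.mem_centralizer_singleton_iff.1 (hT.mem_centralizer_of_mem hw ht hh))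
    intro h
    constructor
    · intro hh
      rwa [key h (hW hh)]
    · intro hh
      have h1 := key _ (hW hh)
      have h2 : t * h * t⁻¹ = h := by
        have := congrArg (fun z => t⁻¹ * z * t) h1
        simpa [mul_assoc] using this
      rwa [h2] at hh
  obtain ⟨⟨t, htW⟩, ht1⟩ := @exists_ne W (Finite.one_lt_card_iff_nontrivial.1 (hcard ▸ hm)) 1
  replace ht1 : t ≠ 1 := fun h => ht1 (Subtype.ext h)
  have hconj : ∀ k ∈ K, ∀ z, k * z * k⁻¹ ∈ Subgroup.centralizer {w} ↔
      z ∈ Subgroup.centralizer {w} := fun k hk =>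
    hT.conj_mem_centralizer_iff hw (hW htW) ht1 (hW ((Subgroup.mem_normalizer_iff.1 hk t).1 htW))
  -- `K` normalizes both `W` and `C(w)`, so it acts by conjugation on the `m` elements of the
  -- difference. Every stabilizer is `C(w)`, so the index `d` of `C(w)` in `K` divides `m`.
  let X := {z : T // z ∈ Subgroup.centralizer {w} ∧ z ∉ W}
  let : MulAction K X :=
    { smul := fun k z => ⟨k * z * (k : T)⁻¹, (hconj k k.2 z).2 z.2.1,
        fun h => z.2.2 ((Subgroup.mem_normalizer_iff.1 k.2 z).2 h)⟩
      one_smul := fun z => Subtype.ext (show (1 : T) * z * (1 : T)⁻¹ = z by simp)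
      mul_smul := fun k l z => Subtype.ext
        (show (k * l : T) * z * (k * l : T)⁻¹ = k * (l * z * (l : T)⁻¹) * (k : T)⁻¹ by group) }
  have hstab : ∀ x : X, Nat.card (MulAction.stabilizer K x) = 2 * m := by
    intro x
    have hx1 : (x : T) ≠ 1 := fun h => x.2.2 (h ▸ one_mem W)
    have hiff : ∀ k : K, k ∈ MulAction.stabilizer K x ↔ (k : T) ∈ Subgroup.centralizer {w} := by
      intro k
      rw [← hT.centralizer_eq hw x.2.1 hx1, Subgroup.mem_centralizer_singleton_iff,
        MulAction.mem_stabilizer_iff, Subtype.ext_iff]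
      exact mul_inv_eq_iff_eq_mul
    rw [← hT.card_centralizer w hw]
    exact Nat.card_congr
      { toFun := fun k => ⟨k.1, (hiff k.1).1 k.2⟩
        invFun := fun t => ⟨⟨t, hUK t.2⟩, (hiff _).2 t.2⟩
        left_inv := fun _ => rfl
        right_inv := fun _ => rfl }
  have hX : Nat.card X = m := by
    have h1 : Nat.card X = ((Subgroup.centralizer {w} : Set T) \ (W : Set T)).ncard :=
      Nat.card_coe_set_eq _
    have h2 : (Subgroup.centralizer {w} : Set T).ncard = 2 * m := hT.card_centralizer w hw
    have h3 : (W : Set T).ncard = m := hcard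
    rw [h1, Set.ncard_sdiff hW, h2, h3]
    omega
  have hd := MulAction.card_dvd_of_card_stabilizer_eq hstab
  rw [hX] at hd
  obtain ⟨d, hd'⟩ : 2 * m ∣ Nat.card K := by
    rw [← hT.card_centralizer w hw]
    exact Subgroup.card_dvd_of_le hUK
  have hd2 : d ∣ (2 * m) ^ 2 - 1 := by
    have := K.card_subgroup_dvd_card
    rw [hd', hT.card_eq] at this
    exact Nat.dvd_of_mul_dvd_mul_left (by omega) this
  rw [hd', Nat.mul_div_cancel_left d (by omega)] at hd
  -- `d` divides the consecutive integers `(2m)² - 1` and `(2m)²`.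
  have hd1 : d = 1 := by
    have h3 : d ∣ (2 * m) ^ 2 := hd.trans ⟨4 * m, by ring⟩
    have h4 := (Nat.dvd_sub h3 hd2)
    rw [Nat.sub_sub_self (Nat.one_le_pow _ _ (by omega))] at h4
    exact Nat.dvd_one.1 h4
  refine (Subgroup.eq_of_le_of_card_ge hUK ?_).ge
  rw [hd', hd1, hT.card_centralizer w hw, mul_one]

/-! ### Fixed points of involutions and orbits of their centralizers. -/

/-- The orbit-stabilizer theorem for a subgroup of the acting group. -/
theorem Subgroup.ncard_orbit_mul_card_inf_stabilizer {T P : Type*} [Group T] [MulAction T P]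
    (H : Subgroup T) (x : P) :
    (MulAction.orbit H x).ncard * Nat.card (H ⊓ MulAction.stabilizer T x : Subgroup T) =
      Nat.card H := by
  rw [← (MulAction.stabilizer H x).card_mul_index, MulAction.index_stabilizer, mul_comm]
  congr 1
  let e : (H ⊓ MulAction.stabilizer T x : Subgroup T) ≃ MulAction.stabilizer H x :=
    { toFun := fun t => ⟨⟨t, t.2.1⟩, t.2.2⟩
      invFun := fun k => ⟨k.1, k.1.2, k.2⟩
      left_inv := fun _ => rfl
      right_inv := fun _ => rfl }
  exact Nat.card_congr e

/-- An action of a group of the type of `SL(2, q)`, `q = 2 * m`, on `m * (2 * m - 1)` points, in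
which the involutions behave as if the point stabilizers were dihedral of order `2 * (q + 1)`. -/
structure IsDihedralAction (T P : Type*) [Group T] [MulAction T P] (m : ℕ) : Prop where
  hasTIInvolutions : HasTIInvolutions T (2 * m)
  one_lt : 1 < m
  card_points : Nat.card P = m * (2 * m - 1)
  card_involutions_fixing : ∀ x : P, {u : T | IsInvolution u ∧ u • x = x}.ncard = 2 * m + 1
  eq_of_mem_centralizer : ∀ (x : P) (u v : T), IsInvolution u → IsInvolution v → u • x = x →
    v • x = x → u ∈ Subgroup.centralizer {v} → u = v

namespace IsDihedralAction

variable {T P : Type*} [Group T] [MulAction T P] {m : ℕ}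

theorem eq_of_fixed [Finite T] (h : IsDihedralAction T P m) {w u v : T} {x : P}
    (hw : IsInvolution w)
    (hu : u ∈ Subgroup.centralizer {w}) (hv : v ∈ Subgroup.centralizer {w}) (hu1 : u ≠ 1)
    (hv1 : v ≠ 1) (hux : u • x = x) (hvx : v • x = x) : u = v :=
  h.eq_of_mem_centralizer x u v ⟨hu1, h.hasTIInvolutions.mul_self w u hw hu⟩
    ⟨hv1, h.hasTIInvolutions.mul_self w v hw hv⟩ hux hvx
    (h.hasTIInvolutions.mem_centralizer_of_mem hw hu hv)

/-- Double counting of pairs of an involution and a point it fixes; conjugate involutions have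
equally many fixed points. -/
theorem ncard_fixedBy [Finite T] [Finite P] (h : IsDihedralAction T P m) {u : T}
    (hu : IsInvolution u) : (MulAction.fixedBy P u).ncard = m := by
  have hm := h.one_lt
  have := Fintype.ofFinite P
  have := Fintype.ofFinite {v : T | IsInvolution v}
  have hconst : ∀ v : {v : T | IsInvolution v},
      Nat.card (MulAction.fixedBy P v.1) = (MulAction.fixedBy P u).ncard := by
    rintro ⟨v, hv⟩
    obtain ⟨c, rfl⟩ := isConj_iff.1 (h.hasTIInvolutions.isConj u v hu hv)
    rw [Nat.card_coe_set_eq, ← MulAction.smul_fixedBy, Set.ncard_smul_set]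
  let e : (Σ v : {v : T | IsInvolution v}, MulAction.fixedBy P v.1) ≃
      (Σ x : P, {v : T | IsInvolution v ∧ v • x = x}) :=
    { toFun := fun p => ⟨p.2.1, p.1.1, p.1.2, p.2.2⟩
      invFun := fun p => ⟨⟨p.2.1, p.2.2.1⟩, p.1, p.2.2.2⟩
      left_inv := fun _ => rfl
      right_inv := fun _ => rfl }
  have h1 := Nat.card_congr e
  rw [Nat.card_sigma, Nat.card_sigma] at h1
  simp only [hconst, Nat.card_coe_set_eq, h.card_involutions_fixing, Finset.sum_const,
    smul_eq_mul, Finset.card_univ, ← Nat.card_eq_fintype_card, h.card_points,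
    h.hasTIInvolutions.card_involutions] at h1
  have h2 : (2 * m) ^ 2 - 1 = (2 * m - 1) * (2 * m + 1) := by
    obtain ⟨k, rfl⟩ : ∃ k, m = k + 1 := ⟨m - 1, by omega⟩
    rw [Nat.sub_eq_iff_eq_add (Nat.one_le_pow _ _ (by omega)),
      show 2 * (k + 1) - 1 = 2 * k + 1 by omega]
    ring
  rw [h2, show m * (2 * m - 1) * (2 * m + 1) = (2 * m - 1) * (2 * m + 1) * m by ring] at h1
  exact Nat.eq_of_mul_eq_mul_left (Nat.mul_pos (by omega) (by omega)) h1

/-- The `2m - 1` involutions of `C(w)` have disjoint fixed-point sets of size `m`, which together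
exhaust the `m(2m - 1)` points. -/
theorem exists_fixing [Finite T] [Finite P] (h : IsDihedralAction T P m) {w : T}
    (hw : IsInvolution w) (x : P) :
    ∃ v ∈ Subgroup.centralizer {w}, IsInvolution v ∧ v • x = x := by
  have hm := h.one_lt
  let A := ((Subgroup.centralizer {w} : Set T) \ {1} : Set T)
  have := Fintype.ofFinite A
  have hA : Nat.card A = 2 * m - 1 := by
    have h1 : (Subgroup.centralizer {w} : Set T).ncard = 2 * m :=
      h.hasTIInvolutions.card_centralizer w hw
    rw [Nat.card_coe_set_eq, Set.ncard_sdiff_singleton_of_mem (one_mem _), h1]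
  have hinv : ∀ v : A, IsInvolution v.1 := fun v =>
    ⟨v.2.2, h.hasTIInvolutions.mul_self w v hw v.2.1⟩
  have hcard : Nat.card (Σ v : A, MulAction.fixedBy P v.1) = Nat.card P := by
    rw [Nat.card_sigma, h.card_points]
    simp only [Nat.card_coe_set_eq, h.ncard_fixedBy (hinv _), Finset.sum_const, smul_eq_mul,
      Finset.card_univ, ← Nat.card_eq_fintype_card (α := A), hA]
    exact mul_comm _ _
  have hinj : Function.Injective (fun p : Σ v : A, MulAction.fixedBy P v.1 => p.2.1) := by
    rintro ⟨⟨v, hv, hv1⟩, y, hy⟩ ⟨⟨u, hu, hu1⟩, z, hz⟩ hyz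
    obtain rfl : y = z := hyz
    obtain rfl : v = u := h.eq_of_fixed hw hv hu hv1 hu1 hy hz
    rfl
  obtain ⟨⟨v, y, hy⟩, hyx⟩ := (hinj.bijective_of_nat_card_le hcard.ge).2 x
  obtain rfl : y = x := hyx
  exact ⟨v, v.2.1, hinv v, hy⟩

theorem orbit_subset_fixedBy {H : Subgroup T} {v : T} (hH : H ≤ Subgroup.centralizer {v})
    {x : P} (hx : v • x = x) : MulAction.orbit H x ⊆ MulAction.fixedBy P v := by
  rintro _ ⟨t, rfl⟩
  change v • (t : T) • x = (t : T) • x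
  rw [smul_smul, ← Subgroup.mem_centralizer_singleton_iff.1 (hH t.2), ← smul_smul, hx]

/-- The stabilizer of `x` in `H` is `{1, v}`. -/
theorem two_mul_ncard_orbit [Finite T] (h : IsDihedralAction T P m) {H : Subgroup T} {v : T}
    (hv : IsInvolution v) (hH : H ≤ Subgroup.centralizer {v}) {x : P} (hx : v • x = x)
    (hvH : v ∈ H) : 2 * (MulAction.orbit H x).ncard = Nat.card H := by
  rw [← H.ncard_orbit_mul_card_inf_stabilizer x, mul_comm]
  congr 1
  have : ((H ⊓ MulAction.stabilizer T x : Subgroup T) : Set T) = {1, v} := by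
    ext t
    constructor
    · rintro ⟨htH, htx⟩
      by_cases ht : t = 1
      · exact .inl ht
      · exact .inr (h.eq_of_fixed hv (hH htH) (hH hvH) ht hv.1 htx hx)
    · rintro (rfl | rfl)
      · exact one_mem (H ⊓ MulAction.stabilizer T x)
      · exact ⟨hvH, hx⟩
  rw [← Set.ncard_pair hv.1.symm, ← this]
  rfl

theorem ncard_orbit_of_not_mem [Finite T] (h : IsDihedralAction T P m) {H : Subgroup T} {v : T}
    (hv : IsInvolution v) (hH : H ≤ Subgroup.centralizer {v}) {x : P} (hx : v • x = x)
    (hvH : v ∉ H) : (MulAction.orbit H x).ncard = Nat.card H := by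
  have hbot : H ⊓ MulAction.stabilizer T x = ⊥ := by
    rw [eq_bot_iff]
    rintro t ⟨htH, htx⟩
    by_contra ht
    exact hvH (h.eq_of_fixed hv (hH htH)
      (Subgroup.self_mem_centralizer_singleton v) ht hv.1 htx hx ▸ htH)
  rw [← H.ncard_orbit_mul_card_inf_stabilizer x, hbot, Subgroup.card_bot, mul_one]

theorem orbit_centralizer_eq [Finite T] [Finite P] (h : IsDihedralAction T P m) {v : T}
    (hv : IsInvolution v) {x : P} (hx : v • x = x) :
    MulAction.orbit (Subgroup.centralizer {v}) x = MulAction.fixedBy P v := by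
  refine Set.eq_of_subset_of_ncard_le (orbit_subset_fixedBy le_rfl hx) ?_ (Set.toFinite _)
  have := h.two_mul_ncard_orbit hv le_rfl hx (Subgroup.self_mem_centralizer_singleton v)
  rw [h.hasTIInvolutions.card_centralizer v hv] at this
  rw [h.ncard_fixedBy hv]
  omega

theorem orbit_stabilizer_subset {B : Set P} {x : P} (hx : x ∈ B) :
    MulAction.orbit (MulAction.stabilizer T B) x ⊆ B := by
  rintro _ ⟨t, rfl⟩
  have := Set.smul_mem_smul_set (a := (t : T)) hx
  rwa [show (t : T) • B = B from t.2] at this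

end IsDihedralAction

/-! ### Blocks with stabilizer of order `m`. -/

namespace IsDihedralAction

variable {T P : Type*} [Group T] [MulAction T P] {m : ℕ}

theorem eq_fixedBy_of_centralizer_le [Finite T] [Finite P] (h : IsDihedralAction T P m)
    {B : Set P} (hB : B.ncard = m) {v : T} (hv : IsInvolution v)
    (hle : Subgroup.centralizer {v} ≤ MulAction.stabilizer T B) {x : P} (hxB : x ∈ B)
    (hx : v • x = x) : B = MulAction.fixedBy P v := by
  refine (Set.eq_of_subset_of_ncard_le ?_ ?_ (Set.toFinite _)).symm
  · rw [← h.orbit_centralizer_eq hv hx]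
    rintro _ ⟨t, rfl⟩
    exact orbit_stabilizer_subset hxB ⟨⟨t, hle t.2⟩, rfl⟩
  · rw [hB, h.ncard_fixedBy hv]

theorem centralizer_le_stabilizer_fixedBy (v : T) :
    Subgroup.centralizer {v} ≤ MulAction.stabilizer T (MulAction.fixedBy P v) := by
  intro t ht
  rw [MulAction.mem_stabilizer_iff, MulAction.smul_fixedBy,
    Subgroup.mem_centralizer_singleton_iff.1 ht, mul_inv_cancel_right]

/-- A block of size `m` whose stabilizer has order `m` and lies in the elementary abelian subgroup
`C(w)`. -/
structure IsHalfBlock (T : Type*) {P : Type*} [Group T] [MulAction T P] (m : ℕ) (w : T)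
    (B : Set P) : Prop where
  isInvolution : IsInvolution w
  ncard_eq : B.ncard = m
  card_stabilizer : Nat.card (MulAction.stabilizer T B) = m
  stabilizer_le : MulAction.stabilizer T B ≤ Subgroup.centralizer {w}

namespace IsHalfBlock

variable [Finite T] {w : T} {B : Set P}

theorem ne_fixedBy (hB : IsHalfBlock T m w B) (h : IsDihedralAction T P m) {v : T}
    (hv : v ∈ Subgroup.centralizer {w}) (hv1 : v ≠ 1) : B ≠ MulAction.fixedBy P v := by
  rintro rfl
  have h1 := Subgroup.card_le_of_le (centralizer_le_stabilizer_fixedBy (P := P) v)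
  rw [h.hasTIInvolutions.centralizer_eq hB.isInvolution hv hv1,
    h.hasTIInvolutions.card_centralizer w hB.isInvolution, hB.card_stabilizer] at h1
  have := h.one_lt
  omega

variable [Finite P]

/-- Otherwise the orbit of `x` under the stabilizer of `B` has `m` points and fills both `B` and the
fixed-point set of `v`, contrary to `ne_fixedBy`. -/
theorem mem_stabilizer_of_fixed (hB : IsHalfBlock T m w B) (h : IsDihedralAction T P m) {v : T}
    (hv : v ∈ Subgroup.centralizer {w}) (hv1 : v ≠ 1) {x : P} (hxB : x ∈ B) (hx : v • x = x) :
    v ∈ MulAction.stabilizer T B := by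
  by_contra hvW
  have hvi : IsInvolution v := ⟨hv1, h.hasTIInvolutions.mul_self w v hB.isInvolution hv⟩
  have hWv : MulAction.stabilizer T B ≤ Subgroup.centralizer {v} := by
    rw [h.hasTIInvolutions.centralizer_eq hB.isInvolution hv hv1]
    exact hB.stabilizer_le
  have h1 := h.ncard_orbit_of_not_mem hvi hWv hx hvW
  rw [hB.card_stabilizer] at h1
  have h2 : MulAction.orbit (MulAction.stabilizer T B) x = B :=
    Set.eq_of_subset_of_ncard_le (orbit_stabilizer_subset hxB) (by rw [h1, hB.ncard_eq])
      (Set.toFinite _)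
  have h3 : MulAction.orbit (MulAction.stabilizer T B) x = MulAction.fixedBy P v :=
    Set.eq_of_subset_of_ncard_le (orbit_subset_fixedBy hWv hx) (by rw [h1, h.ncard_fixedBy hvi])
      (Set.toFinite _)
  exact hB.ne_fixedBy h hv hv1 (h2.symm.trans h3)

theorem two_mul_ncard_orbit (hB : IsHalfBlock T m w B) (h : IsDihedralAction T P m) {v : T}
    (hv : v ∈ Subgroup.centralizer {w}) (hv1 : v ≠ 1) {x : P} (hxB : x ∈ B) (hx : v • x = x) :
    2 * (MulAction.orbit (MulAction.stabilizer T B) x).ncard = m := by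
  have hvi : IsInvolution v := ⟨hv1, h.hasTIInvolutions.mul_self w v hB.isInvolution hv⟩
  rw [h.two_mul_ncard_orbit hvi _ hx (hB.mem_stabilizer_of_fixed h hv hv1 hxB hx),
    hB.card_stabilizer]
  rw [h.hasTIInvolutions.centralizer_eq hB.isInvolution hv hv1]
  exact hB.stabilizer_le

/-- Two points of a block in different orbits of its stabilizer: the block is the union of these
orbits. -/
theorem eq_union_orbits (hB : IsHalfBlock T m w B) (h : IsDihedralAction T P m) {x y : P}
    (hx : x ∈ B) (hy : y ∈ B) (hxy : y ∉ MulAction.orbit (MulAction.stabilizer T B) x) :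
    MulAction.orbit (MulAction.stabilizer T B) x ∪ MulAction.orbit (MulAction.stabilizer T B) y =
      B := by
  obtain ⟨u, huw, hu, hux⟩ := h.exists_fixing hB.isInvolution x
  obtain ⟨v, hvw, hv, hvy⟩ := h.exists_fixing hB.isInvolution y
  refine Set.eq_of_subset_of_ncard_le
    (Set.union_subset (orbit_stabilizer_subset hx) (orbit_stabilizer_subset hy)) ?_ (Set.toFinite _)
  rw [Set.ncard_union_eq _ (Set.toFinite _) (Set.toFinite _), hB.ncard_eq]
  · have h1 := hB.two_mul_ncard_orbit h huw hu.1 hx hux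
    have h2 := hB.two_mul_ncard_orbit h hvw hv.1 hy hvy
    omega
  · rw [Set.disjoint_left]
    intro z hzx hzy
    rw [← MulAction.orbit_eq_iff] at hzx hzy
    exact hxy (by rw [← hzx, hzy]; exact MulAction.mem_orbit_self y)

/-- If `x` and `tx` share an orbit of the stabilizer, `t` differs from a stabilizing element by one
fixing `x`. If not, their two orbits make up `B`, and the involution of `C(w)` fixing `x` fixes both
pointwise, contrary to `ne_fixedBy`. -/
theorem mem_stabilizer_of_smul_mem (hB : IsHalfBlock T m w B) (h : IsDihedralAction T P m) {t : T}
    (ht : t ∈ Subgroup.centralizer {w}) {x : P} (hx : x ∈ B) (htx : t • x ∈ B) :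
    t ∈ MulAction.stabilizer T B := by
  obtain ⟨v, hvw, hv, hvx⟩ := h.exists_fixing hB.isInvolution x
  have hW : MulAction.stabilizer T B ≤ Subgroup.centralizer {v} := by
    rw [h.hasTIInvolutions.centralizer_eq hB.isInvolution hvw hv.1]
    exact hB.stabilizer_le
  by_cases hmem : t • x ∈ MulAction.orbit (MulAction.stabilizer T B) x
  · obtain ⟨s, hs⟩ := hmem
    change (s : T) • x = t • x at hs
    have hfix : ((s : T)⁻¹ * t) • x = x := by rw [mul_smul, ← hs, inv_smul_smul]
    have hmem : (s : T)⁻¹ * t ∈ Subgroup.centralizer {w} :=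
      mul_mem (inv_mem (hB.stabilizer_le s.2)) ht
    rw [← (MulAction.stabilizer T B).mul_mem_cancel_left (inv_mem s.2)]
    by_cases h1 : (s : T)⁻¹ * t = 1
    · rw [h1]
      exact one_mem _
    · exact hB.mem_stabilizer_of_fixed h hmem h1 hx hfix
  · have hvtx : v • t • x = t • x := by
      rw [smul_smul, ← Subgroup.mem_centralizer_singleton_iff.1
        (h.hasTIInvolutions.mem_centralizer_of_mem hB.isInvolution ht hvw), ← smul_smul, hvx]
    have hsub : B ⊆ MulAction.fixedBy P v := by
      rw [← hB.eq_union_orbits h hx htx hmem]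
      exact Set.union_subset (orbit_subset_fixedBy hW hvx) (orbit_subset_fixedBy hW hvtx)
    exact (hB.ne_fixedBy h hvw hv.1 (Set.eq_of_subset_of_ncard_le hsub
      (by rw [hB.ncard_eq, h.ncard_fixedBy hv]) (Set.toFinite _))).elim

/-- The points of a block are fixed by one of two involutions in `C(w)`. -/
theorem exists_second_involution (hB : IsHalfBlock T m w B) (h : IsDihedralAction T P m) {x : P}
    (hxB : x ∈ B) {u : T} (huw : u ∈ Subgroup.centralizer {w}) (hu1 : u ≠ 1) (hux : u • x = x) :
    ∃ v ∈ Subgroup.centralizer {w}, v ≠ 1 ∧ v ≠ u ∧ ∀ y ∈ B, u • y = y ∨ v • y = y := by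
  have hle : ∀ v ∈ Subgroup.centralizer {w}, v ≠ 1 →
      MulAction.stabilizer T B ≤ Subgroup.centralizer {v} := fun v hv hv1 => by
    rw [h.hasTIInvolutions.centralizer_eq hB.isInvolution hv hv1]
    exact hB.stabilizer_le
  have hui : IsInvolution u := ⟨hu1, h.hasTIInvolutions.mul_self w u hB.isInvolution huw⟩
  obtain ⟨y, hyB, hyu⟩ : ∃ y ∈ B, u • y ≠ y := by
    by_contra! hall
    exact hB.ne_fixedBy h huw hu1 (Set.eq_of_subset_of_ncard_le hall
      (by rw [hB.ncard_eq, h.ncard_fixedBy hui]) (Set.toFinite _))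
  obtain ⟨v, hvw, hv, hvy⟩ := h.exists_fixing hB.isInvolution y
  refine ⟨v, hvw, hv.1, fun e => hyu (e ▸ hvy), fun z hz => ?_⟩
  have hy : y ∉ MulAction.orbit (MulAction.stabilizer T B) x := fun hmem =>
    hyu (orbit_subset_fixedBy (hle u huw hu1) hux hmem)
  rw [← hB.eq_union_orbits h hxB hyB hy] at hz
  exact hz.imp (fun hz => orbit_subset_fixedBy (hle u huw hu1) hux hz)
    (fun hz => orbit_subset_fixedBy (hle v hvw hv.1) hvy hz)

end IsHalfBlock

/-- In a `T`-invariant `2`-design whose blocks have size `m`, with `2 * ((2 * m) ^ 2 - 1)` blocks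
and `2` blocks through any two points, no block has an elementary abelian stabilizer of
order `m`. -/
theorem false_of_card_stabilizer_eq [Finite T] [Finite P] (h : IsDihedralAction T P m)
    (hm : 2 < m) {𝓑 : Set (Set P)} (hblock : ∀ B ∈ 𝓑, B.ncard = m)
    (hpair : ∀ x y : P, x ≠ y → {B ∈ 𝓑 | x ∈ B ∧ y ∈ B}.ncard = 2)
    (hinv : ∀ t : T, ∀ B ∈ 𝓑, t • B ∈ 𝓑) (hcard : 𝓑.ncard = 2 * ((2 * m) ^ 2 - 1))
    {B : Set P} (hB : B ∈ 𝓑) (hWcard : Nat.card (MulAction.stabilizer T B) = m)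
    (hW : ∀ t ∈ MulAction.stabilizer T B, t * t = 1) : False := by
  have hT := h.hasTIInvolutions
  -- The orbit of `B` has `|T| / m = 2((2m)² - 1)` members, as many as there are blocks.
  have htrans : ∀ D ∈ 𝓑, ∃ g : T, g • B = D := by
    have h1 := (MulAction.stabilizer T B).card_mul_index
    rw [MulAction.index_stabilizer, hWcard, hT.card_eq] at h1
    have h2 : MulAction.orbit T B = 𝓑 := by
      refine Set.eq_of_subset_of_ncard_le ?_ ?_ (Set.toFinite _)
      · rintro _ ⟨t, rfl⟩
        exact hinv t B hB
      · rw [hcard]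
        refine (Nat.eq_of_mul_eq_mul_left (show 0 < m by omega) (h1.trans ?_)).ge
        ring
    intro D hD
    rw [← h2] at hD
    exact hD
  obtain ⟨⟨w, hwW⟩, hw1⟩ := @exists_ne (MulAction.stabilizer T B)
    (Finite.one_lt_card_iff_nontrivial.1 (hWcard ▸ h.one_lt)) 1
  replace hw1 : w ≠ 1 := fun e => hw1 (Subtype.ext e)
  have hw : IsInvolution w := ⟨hw1, hW w hwW⟩
  have hHB : IsHalfBlock T m w B :=
    ⟨hw, hblock B hB, hWcard, Subgroup.le_centralizer_of_mul_self hW hwW⟩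
  obtain ⟨x, hx⟩ : B.Nonempty := by
    rw [← Set.ncard_pos, hblock B hB]
    omega
  obtain ⟨u, huw, hu, hux⟩ := h.exists_fixing hw x
  obtain ⟨v, hvw, hv1, hvu, hBuv⟩ := hHB.exists_second_involution h hx huw hu.1 hux
  -- A block `D = g • B` other than `B` through `x` whose stabilizer meets `C(w)`.
  have hother : ∀ g : T, x ∈ g • B → g • B ≠ B → ∀ t ∈ MulAction.stabilizer T (g • B), t ≠ 1 →
      t ∈ Subgroup.centralizer {w} →
      g⁻¹ * u * g = v ∧ IsHalfBlock T m w (g • B) := by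
    intro g hxg hgB t ht ht1 htw
    have hstab : ∀ z, z ∈ MulAction.stabilizer T (g • B) ↔
        g⁻¹ * z * g⁻¹⁻¹ ∈ MulAction.stabilizer T B := fun z => by
      rw [MulAction.mem_stabilizer_iff, MulAction.mem_stabilizer_iff, inv_inv, mul_smul, mul_smul,
        inv_smul_eq_iff]
    -- `g⁻¹` normalizes `C(w)`, so `g⁻¹ug` lies in `C(w)` and fixes `g⁻¹x ∈ B`: it is `u` or `v`.
    -- The value `u` would put `g` in `C(w)` and then in the stabilizer of `B`.
    have hconj := hT.conj_mem_centralizer_iff (g := g⁻¹) hw htw ht1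
      (hHB.stabilizer_le ((hstab t).1 ht))
    have hxB : g⁻¹ • x ∈ B := Set.mem_smul_set_iff_inv_smul_mem.1 hxg
    have hfix : (g⁻¹ * u * g⁻¹⁻¹) • g⁻¹ • x = g⁻¹ • x := by
      rw [mul_smul, inv_inv, smul_inv_smul, mul_smul, hux]
    have hne : g⁻¹ * u * g⁻¹⁻¹ ≠ 1 := (hu.conj g⁻¹).1
    constructor
    · rcases hBuv _ hxB with h1 | h1
      · have h2 := h.eq_of_fixed hw ((hconj u).2 huw) huw hne hu.1 hfix h1
        have h3 : g⁻¹ ∈ Subgroup.centralizer {w} := by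
          rw [← hT.centralizer_eq hw huw hu.1, Subgroup.mem_centralizer_singleton_iff]
          exact mul_inv_eq_iff_eq_mul.1 h2
        have h4 := hHB.mem_stabilizer_of_smul_mem h h3 hx hxB
        exact (hgB (inv_mem_iff.1 h4)).elim
      · have h2 := h.eq_of_fixed hw ((hconj u).2 huw) hvw hne hv1 hfix h1
        rwa [inv_inv] at h2
    · refine ⟨hw, by rw [Set.ncard_smul_set, hblock B hB], ?_, fun z hz =>
        (hconj z).1 (hHB.stabilizer_le ((hstab z).1 hz))⟩
      rw [← hWcard]
      exact Nat.card_congr ((MulAut.conj g⁻¹).toEquiv.subtypeEquiv hstab)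
  have hunique : ∀ D D' : Set P, D ∈ 𝓑 → D' ∈ 𝓑 → x ∈ D → x ∈ D' → D ≠ B → D' ≠ B →
      (∃ t ∈ MulAction.stabilizer T D, t ≠ 1 ∧ t ∈ Subgroup.centralizer {w}) →
      (∃ t ∈ MulAction.stabilizer T D', t ≠ 1 ∧ t ∈ Subgroup.centralizer {w}) → D = D' := by
    rintro D D' hD hD' hxD hxD' hDB hDB' ⟨t, ht, ht1, htw⟩ ⟨t', ht', ht1', htw'⟩
    obtain ⟨g, rfl⟩ := htrans D hD
    obtain ⟨g', rfl⟩ := htrans D' hD'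
    obtain ⟨h1, h2⟩ := hother g hxD hDB t ht ht1 htw
    obtain ⟨h1', -⟩ := hother g' hxD' hDB' t' ht' ht1' htw'
    -- Both `g` and `g'` conjugate `u` to the same `v`. The quotient `gg'⁻¹` takes `D'` to `D` and
    -- keeps `x` in `D`, so it stabilizes `D`.
    have hs : g * g'⁻¹ ∈ Subgroup.centralizer {w} := by
      rw [← hT.centralizer_eq hw huw hu.1, Subgroup.mem_centralizer_singleton_iff]
      calc g * g'⁻¹ * u = g * (g'⁻¹ * u * g') * g'⁻¹ := by group
        _ = u * (g * g'⁻¹) := by rw [h1', ← h1]; group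
    have hsx : (g * g'⁻¹) • x ∈ g • B := by
      rw [mul_smul]
      exact Set.smul_mem_smul_set (Set.mem_smul_set_iff_inv_smul_mem.1 hxD')
    have h3 := inv_mem (h2.mem_stabilizer_of_smul_mem h hs hxD hsx)
    rw [MulAction.mem_stabilizer_iff, smul_smul] at h3
    rw [← h3]
    congr 1
    group
  have hexists : ∀ t ∈ MulAction.stabilizer T B, t ≠ 1 → t ≠ u →
      ∃ D ∈ 𝓑, x ∈ D ∧ D ≠ B ∧ t ∈ MulAction.stabilizer T D := by
    intro t ht ht1 htu
    have htw := hHB.stabilizer_le ht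
    have htx : x ≠ t • x := fun e => htu (h.eq_of_fixed hw htw huw ht1 hu.1 e.symm hux)
    have h2 := hpair x (t • x) htx
    have htxB : t • x ∈ B := by
      have := Set.smul_mem_smul_set (a := t) hx
      rwa [MulAction.mem_stabilizer_iff.1 ht] at this
    have hBS : B ∈ {D ∈ 𝓑 | x ∈ D ∧ t • x ∈ D} := ⟨hB, hx, htxB⟩
    obtain ⟨D, ⟨hD, hxD, htxD⟩, hDB⟩ :=
      Set.exists_ne_of_one_lt_ncard (one_lt_two.trans_eq h2.symm) B
    refine ⟨D, hD, hxD, hDB, ?_⟩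
    by_contra htD
    -- The involution `t` swaps `x` and `tx`; if it moved `D`, there would be three blocks on this
    -- pair.
    have h3 : ({B, D, t • D} : Set (Set P)) ⊆ {D ∈ 𝓑 | x ∈ D ∧ t • x ∈ D} := by
      rintro E (rfl | rfl | rfl)
      · exact hBS
      · exact ⟨hD, hxD, htxD⟩
      · refine ⟨hinv t D hD, ?_, Set.smul_mem_smul_set hxD⟩
        have := Set.smul_mem_smul_set (a := t) htxD
        rwa [smul_smul, hW t ht, one_smul] at this
    have h4 : ({B, D, t • D} : Set (Set P)).ncard = 3 := by
      refine Set.ncard_eq_three.2 ⟨B, D, t • D, hDB.symm, fun e => hDB ?_, fun e => htD e.symm, rfl⟩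
      rw [← smul_left_cancel_iff t, ← e, MulAction.mem_stabilizer_iff.1 ht]
    have h5 := Set.ncard_le_ncard h3 (Set.toFinite _)
    omega
  -- This is where `m > 2` enters.
  obtain ⟨t₀, ht₀, ht₀'⟩ : ∃ t ∈ (MulAction.stabilizer T B : Set T), t ∉ ({1, u} : Set T) := by
    refine Set.exists_mem_notMem_of_ncard_lt_ncard ?_ (Set.toFinite _)
    have h1 : (MulAction.stabilizer T B : Set T).ncard = m := hWcard
    have h2 := Set.ncard_insert_le (1 : T) {u}
    rw [Set.ncard_singleton] at h2
    omega
  simp only [Set.mem_insert_iff, Set.mem_singleton_iff, not_or] at ht₀'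
  obtain ⟨D, hD, hxD, hDB, ht₀D⟩ := hexists t₀ ht₀ ht₀'.1 ht₀'.2
  obtain ⟨g, rfl⟩ := htrans D hD
  have ht₀w := hHB.stabilizer_le ht₀
  obtain ⟨hgu, hHD⟩ := hother g hxD hDB t₀ ht₀D ht₀'.1 ht₀w
  have hle : MulAction.stabilizer T B ≤ MulAction.stabilizer T (g • B) := by
    intro t ht
    by_cases ht1 : t = 1
    · rw [ht1]
      exact one_mem _
    by_cases htu : t = u
    · rw [htu]
      exact hHD.mem_stabilizer_of_fixed h huw hu.1 hxD hux
    obtain ⟨E, hE, hxE, hEB, htE⟩ := hexists t ht ht1 htu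
    rwa [hunique (g • B) E hD hE hxD hxE hDB hEB ⟨t₀, ht₀D, ht₀'.1, ht₀w⟩
      ⟨t, htE, ht1, hHB.stabilizer_le ht⟩]
  have heq := Subgroup.eq_of_le_of_card_ge hle (by rw [hHD.card_stabilizer, hWcard])
  have hgN : g⁻¹ ∈ Subgroup.normalizer (MulAction.stabilizer T B : Set T) := by
    rw [Subgroup.mem_normalizer_iff]
    intro z
    nth_rw 1 [heq]
    rw [MulAction.mem_stabilizer_iff, MulAction.mem_stabilizer_iff, inv_inv, mul_smul, mul_smul,
      inv_smul_eq_iff]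
  have hgw := hT.normalizer_le h.one_lt hw hHB.stabilizer_le hWcard hgN
  have h1 := hT.mem_centralizer_of_mem hw hgw huw
  rw [Subgroup.mem_centralizer_singleton_iff] at h1
  rw [h1, inv_mul_cancel_right] at hgu
  exact hvu hgu.symm

end IsDihedralAction

/-! ### Counting blocks with stabilizer of order `2m`. -/

namespace IsDihedralAction

variable {T P : Type*} [Group T] [MulAction T P] {m : ℕ}

/-- In a `T`-invariant family of `m`-sets with elementary abelian stabilizers of order `2 * m`
there are at most `(2 * m) ^ 2 - 1` members. -/
theorem ncard_le_of_card_stabilizer_eq [Finite T] [Finite P] (h : IsDihedralAction T P m)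
    {𝓑 : Set (Set P)} (hblock : ∀ B ∈ 𝓑, B.ncard = m)
    (hWcard : ∀ B ∈ 𝓑, Nat.card (MulAction.stabilizer T B) = 2 * m)
    (hW : ∀ B ∈ 𝓑, ∀ t ∈ MulAction.stabilizer T B, t * t = 1) :
    𝓑.ncard ≤ (2 * m) ^ 2 - 1 := by
  have hm := h.one_lt
  have hT := h.hasTIInvolutions
  rw [← hT.card_involutions]
  -- Every member is the fixed-point set of an involution, because its stabilizer is a full
  -- centralizer `C(w)`.
  refine (Set.ncard_le_ncard (t := MulAction.fixedBy P '' {u : T | IsInvolution u}) ?_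
    (Set.toFinite _)).trans (Set.ncard_image_le (Set.toFinite _))
  intro B hB
  obtain ⟨⟨w, hwW⟩, hw1⟩ := @exists_ne (MulAction.stabilizer T B)
    (Finite.one_lt_card_iff_nontrivial.1 (by rw [hWcard B hB]; omega)) 1
  replace hw1 : w ≠ 1 := fun e => hw1 (Subtype.ext e)
  have hw : IsInvolution w := ⟨hw1, hW B hB w hwW⟩
  have hWw := Subgroup.eq_of_le_of_card_ge (Subgroup.le_centralizer_of_mul_self (hW B hB) hwW)
    (by rw [hWcard B hB, hT.card_centralizer w hw])
  obtain ⟨x, hx⟩ : B.Nonempty := by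
    rw [← Set.ncard_pos, hblock B hB]
    omega
  obtain ⟨v, hvw, hv, hvx⟩ := h.exists_fixing hw x
  refine ⟨v, hv, (h.eq_fixedBy_of_centralizer_le (hblock B hB) hv ?_ hx hvx).symm⟩
  rw [hT.centralizer_eq hw hvw hv.1, hWw]

theorem not_isTwoDesign [Finite T] [Finite P] (h : IsDihedralAction T P m) (hm : 2 < m)
    {𝓑 : Set (Set P)} (hblock : ∀ B ∈ 𝓑, B.ncard = m)
    (hinv : ∀ t : T, ∀ B ∈ 𝓑, t • B ∈ 𝓑) (hcard : 𝓑.ncard = 2 * ((2 * m) ^ 2 - 1))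
    (hWcard : ∀ B ∈ 𝓑, Nat.card (MulAction.stabilizer T B) = m ∨
      Nat.card (MulAction.stabilizer T B) = 2 * m)
    (hW : ∀ B ∈ 𝓑, ∀ t ∈ MulAction.stabilizer T B, t * t = 1) :
    ¬ ∀ x y : P, x ≠ y → {B ∈ 𝓑 | x ∈ B ∧ y ∈ B}.ncard = 2 := by
  intro hpair
  by_cases hex : ∃ B ∈ 𝓑, Nat.card (MulAction.stabilizer T B) = m
  · obtain ⟨B, hB, hBm⟩ := hex
    exact h.false_of_card_stabilizer_eq hm hblock hpair hinv hcard hB hBm (hW B hB)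
  · push Not at hex
    have h1 := h.ncard_le_of_card_stabilizer_eq hblock
      (fun B hB => (hWcard B hB).resolve_left (hex B hB)) hW
    have h2 : 1 < (2 * m) ^ 2 := Nat.one_lt_pow two_ne_zero (by omega)
    omega

end IsDihedralAction

/-! ### Dihedral point stabilizers. -/

section Dihedral

theorem ZMod.eq_zero_of_add_self_eq_zero {n : ℕ} (hn : Odd n) {i : ZMod n} (hi : i + i = 0) :
    i = 0 := by
  have h2 : IsUnit (2 : ZMod n) := by
    have := (ZMod.isUnit_iff_coprime 2 n).2 (Nat.coprime_two_left.2 hn)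
    exact_mod_cast this
  rw [← two_mul] at hi
  exact h2.mul_right_eq_zero.1 hi

theorem DihedralGroup.isInvolution_iff {n : ℕ} (hn : Odd n) (a : DihedralGroup n) :
    IsInvolution a ↔ ∃ i, a = .sr i := by
  cases a with
  | r i =>
    simp only [IsInvolution, DihedralGroup.r_mul_r, DihedralGroup.one_def, ne_eq,
      DihedralGroup.r.injEq, reduceCtorEq, exists_false, iff_false, not_and]
    exact fun h1 h2 => h1 (ZMod.eq_zero_of_add_self_eq_zero hn h2)
  | sr i => simp [IsInvolution, DihedralGroup.sr_mul_sr, DihedralGroup.one_def, -DihedralGroup.r_zero]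

theorem DihedralGroup.ncard_involutions {n : ℕ} (hn : Odd n) :
    {a : DihedralGroup n | IsInvolution a}.ncard = n := by
  have : {a : DihedralGroup n | IsInvolution a} = Set.range DihedralGroup.sr := by
    ext a
    simp [DihedralGroup.isInvolution_iff hn, eq_comm]
  rw [this, ← Nat.card_coe_set_eq,
    Nat.card_range_of_injective (fun i j h => DihedralGroup.sr.inj h), Nat.card_zmod]

/-- Commuting reflections `sr i`, `sr j` satisfy `2(i - j) = 0`, and `2` is invertible modulo odd
`n`. -/
theorem DihedralGroup.eq_of_commute {n : ℕ} (hn : Odd n) {a b : DihedralGroup n}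
    (ha : IsInvolution a) (hb : IsInvolution b) (hab : a * b = b * a) : a = b := by
  obtain ⟨i, rfl⟩ := (DihedralGroup.isInvolution_iff hn a).1 ha
  obtain ⟨j, rfl⟩ := (DihedralGroup.isInvolution_iff hn b).1 hb
  simp only [DihedralGroup.sr_mul_sr, DihedralGroup.r.injEq] at hab
  have : i - j = 0 := ZMod.eq_zero_of_add_self_eq_zero hn (by linear_combination -hab)
  rw [sub_eq_zero.1 this]

theorem Subgroup.isInvolution_coe_iff {T : Type*} [Group T] {H : Subgroup T} (u : H) :
    IsInvolution (u : T) ↔ IsInvolution u := by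
  rw [IsInvolution, IsInvolution, ← Subgroup.coe_mul, ne_eq, OneMemClass.coe_eq_one,
    OneMemClass.coe_eq_one]

theorem IsDihedralAction.of_stabilizer {T P : Type*} [Group T] [MulAction T P] {m : ℕ}
    (hT : HasTIInvolutions T (2 * m)) (hm : 1 < m) (hP : Nat.card P = m * (2 * m - 1))
    (hstab : ∀ x : P, Nonempty (MulAction.stabilizer T x ≃* DihedralGroup (2 * m + 1))) :
    IsDihedralAction T P m where
  hasTIInvolutions := hT
  one_lt := hm
  card_points := hP
  card_involutions_fixing x := by
    obtain ⟨e⟩ := hstab x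
    rw [← DihedralGroup.ncard_involutions (n := 2 * m + 1) ⟨m, rfl⟩, ← Nat.card_coe_set_eq,
      ← Nat.card_coe_set_eq]
    exact Nat.card_congr
      { toFun := fun u => ⟨e ⟨u, u.2.2⟩, e.isInvolution_iff.2
          ((Subgroup.isInvolution_coe_iff _).1 u.2.1)⟩
        invFun := fun a => ⟨e.symm a, (Subgroup.isInvolution_coe_iff _).2
          (e.symm.isInvolution_iff.2 a.2), (e.symm a).2⟩
        left_inv := fun u => Subtype.ext (by simp)
        right_inv := fun a => Subtype.ext (e.apply_symm_apply a.1) }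
  eq_of_mem_centralizer x u v hu hv hux hvx huv := by
    obtain ⟨e⟩ := hstab x
    have h1 : e ⟨u, hux⟩ = e ⟨v, hvx⟩ := by
      refine DihedralGroup.eq_of_commute ⟨m, rfl⟩
        (e.isInvolution_iff.2 ((Subgroup.isInvolution_coe_iff _).1 hu))
        (e.isInvolution_iff.2 ((Subgroup.isInvolution_coe_iff _).1 hv)) ?_
      rw [← map_mul, ← map_mul]
      congr 1
      exact Subtype.ext (Subgroup.mem_centralizer_singleton_iff.1 huv)
    exact congrArg Subtype.val (e.injective h1)

end Dihedral

/-! ### Elementary abelian block stabilizers and the conclusion. -/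

theorem ElemAbelianTwo.mul_self {n : ℕ} (a : ElemAbelianTwo n) : a * a = 1 :=
  Multiplicative.toAdd.injective (funext fun i => CharTwo.add_self_eq_zero (a.toAdd i))

theorem ElemAbelianTwo.nat_card (n : ℕ) : Nat.card (ElemAbelianTwo n) = 2 ^ n := by
  rw [Nat.card_congr Multiplicative.toAdd, Nat.card_fun, Nat.card_zmod, Nat.card_fin]

theorem Subgroup.mul_self_of_mulEquiv_elemAbelianTwo {T : Type*} [Group T] {H : Subgroup T} {n : ℕ}
    (e : H ≃* ElemAbelianTwo n) {t : T} (ht : t ∈ H) : t * t = 1 := by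
  have : (⟨t, ht⟩ : H) * ⟨t, ht⟩ = 1 := e.injective (by
    rw [map_mul, map_one]
    exact ElemAbelianTwo.mul_self _)
  exact congrArg Subtype.val this

theorem theorem2p2 {P : Type*} [Finite P] (𝓑 : Set (Set P)) (G : Subgroup (Equiv.Perm P))
    (q f : ℕ) : ¬ IsTypeI 𝓑 G q f := by
  intro h
  -- From here on `m = 2 ^ n`.
  obtain ⟨n, rfl⟩ : ∃ n, f = n + 1 := Nat.exists_eq_succ_of_ne_zero fun hf => by
    have h1 := h.q_eq
    have h2 := h.q_gt
    rw [hf] at h1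
    omega
  have hq : q = 2 * 2 ^ n := by rw [h.q_eq, pow_succ']
  have hq2 : q / 2 = 2 ^ n := by omega
  have hT : HasTIInvolutions (groupSocle G) (2 * 2 ^ n) := by
    obtain ⟨e⟩ := h.socle_iso
    have h1 := hasTIInvolutions_projectiveSpecialLinearGroup (F := GaloisField 2 (n + 1))
    rw [GaloisField.card 2 (n + 1) (Nat.succ_ne_zero n), pow_succ'] at h1
    exact h1.of_mulEquiv e
  have hm : 2 < 2 ^ n := hq2 ▸ h.nontrivial.1
  have hact : IsDihedralAction (groupSocle G) P (2 ^ n) := by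
    refine .of_stabilizer hT (by omega) ?_ fun x => ?_
    · rw [h.design.card_points, hq, mul_assoc, Nat.mul_div_cancel_left _ two_pos]
    · rw [← hq]
      exact h.point_stabilizer x
  refine hact.not_isTwoDesign hm (𝓑 := 𝓑) (fun B hB => hq2 ▸ h.design.card_block B hB) ?_
    (hq ▸ h.card_blocks) ?_ ?_ h.design.card_pair
  · intro t B hB
    have h1 : (t : Equiv.Perm P) • 𝓑 = 𝓑 := h.le_aut (t : G).2
    have h2 := Set.smul_mem_smul_set (a := (t : Equiv.Perm P)) hB
    rw [h1] at h2
    exact h2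
  · intro B hB
    rcases h.block_stabilizer B hB with ⟨⟨e⟩⟩ | ⟨⟨e⟩⟩
    · left
      rw [Nat.card_congr e.toEquiv, ElemAbelianTwo.nat_card, Nat.add_sub_cancel]
    · right
      rw [Nat.card_congr e.toEquiv, ElemAbelianTwo.nat_card, pow_succ']
  · intro B hB t ht
    rcases h.block_stabilizer B hB with ⟨⟨e⟩⟩ | ⟨⟨e⟩⟩
    · exact Subgroup.mul_self_of_mulEquiv_elemAbelianTwo e ht
    · exact Subgroup.mul_self_of_mulEquiv_elemAbelianTwo e ht
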